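/- Let $n\ge 1$ and let $(\Omega,\Sigma,\mu)$ be a probability space whose points are separated, outside some $\mu$-null set, by a countable family of measurable sets (for example a standard Borel or a Lebesgue probability space). Let $U_1,\dots,U_n$ be commuting invertible measure-preserving transformations of $(\Omega,\Sigma,\mu)$ that form a non-periodic collection, meaning that $\mu\{x\in\Omega : U_1^{l_1}\cdots U_n^{l_n}x=x\}=0$ for every $(l_1,\dots,l_n)\in\mathbb Z^n\setminus\{0\}$. For $f:\Omega\to\mathbb R$ and $g:\mathbb Z^n\to\mathbb R$ define \[ M_S^* f(\omega)=\sup_{R\ni 0}\frac1{\#(R\cap\mathbb Z^n)}\sum_{j\in R\cap\mathbb Z^n}|f(U_1^{j_1}\cdots U_n^{j_n}\omega)|,\qquad \tilde M_S g(m)=\sup_{R\ni 0}\frac1{\#(R\cap\mathbb Z^n)}\sum_{j\in R\cap\mathbb Z^n}|g(m+j)|, \] for $\omega\in\Omega$ and $m\in\mathbb Z^n$, where the suprema are taken over all open rectangles $R\subset\mathbb R^n$ containing the origin whose sides are parallel to the coordinate axes. For $0<\alpha<1$ define the Tauberian constants, with values in $[0,\infty]$, \[ C_S^*(\alpha)=\sup_{E\in\Sigma,\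 \mu(E)>0}\frac{\mu(\{\omega\in\Omega : M_S^*\chi_E(\omega)>\alpha\})}{\mu(E)},\qquad \tilde C_S(\alpha)=\sup_{E\subset\mathbb Z^n,\ 0<\#E<\infty}\frac{\#\{m\in\mathbb Z^n : \tilde M_S\chi_E(m)>\alpha\}}{\#E}. \] Then $C_S^*(\alpha)=\tilde C_S(\alpha)$ for every $\alpha\in(0,1)$. -/

import Mathlib

open MeasureTheory
open scoped ENNReal

noncomputable section

namespace StrongMaximal

/-- The open rectangle `(a₁,b₁) × ⋯ × (aₙ,bₙ)` in `ℝⁿ`, with sides parallel to the axes. -/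
def openRect {n : ℕ} (a b : Fin n → ℝ) : Set (Fin n → ℝ) :=
  Set.univ.pi fun i => Set.Ioo (a i) (b i)

/-- The set `R ∩ ℤⁿ` for the open rectangle `R` with corners `a` and `b` is finite. -/
theorem finite_lattice_openRect {n : ℕ} (a b : Fin n → ℝ) :
    {j : Fin n → ℤ | (fun i => (j i : ℝ)) ∈ openRect a b}.Finite := by
  refine (Set.finite_Icc (fun i => ⌊a i⌋) (fun i => ⌈b i⌉)).subset ?_
  intro j hj
  have hj' : ∀ i, a i < (j i : ℝ) ∧ (j i : ℝ) < b i := fun i => hj i (Set.mem_univ i)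
  refine ⟨fun i => ?_, fun i => ?_⟩
  · exact_mod_cast (Int.floor_le (a i)).trans (hj' i).1.le
  · exact_mod_cast (hj' i).2.le.trans (Int.le_ceil (b i))

/-- The finite set `R ∩ ℤⁿ`, where `R` is the open rectangle with corners `a` and `b`. -/
def latticePoints {n : ℕ} (a b : Fin n → ℝ) : Finset (Fin n → ℤ) :=
  (finite_lattice_openRect a b).toFinset

/-- The discrete strong maximal operator on `ℤⁿ`: the supremum, over all open axis-parallel
rectangles `R` containing the origin, of the average of `|f (m + j)|` over `j ∈ R ∩ ℤⁿ`. -/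
def discreteMaximal {n : ℕ} (f : (Fin n → ℤ) → ℝ) (m : Fin n → ℤ) : ℝ≥0∞ :=
  ⨆ (a : Fin n → ℝ) (b : Fin n → ℝ) (_ : (0 : Fin n → ℝ) ∈ openRect a b),
    (∑ j ∈ latticePoints a b, ‖f (m + j)‖ₑ) / ((latticePoints a b).card : ℝ≥0∞)

/-- The Tauberian constant of the discrete strong maximal operator on `ℤⁿ`, a supremum over
the finite nonempty sets `E ⊆ ℤⁿ`. -/
def discreteTauberian (n : ℕ) (α : ℝ) : ℝ≥0∞ :=
  ⨆ (E : Finset (Fin n → ℤ)) (_ : E.Nonempty),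
    ({m : Fin n → ℤ | ENNReal.ofReal α <
        discreteMaximal ((E : Set (Fin n → ℤ)).indicator 1) m}.encard : ℝ≥0∞) /
      (E.card : ℝ≥0∞)

variable {Ω : Type*} [MeasurableSpace Ω]

/-- The composition `U₁^{j₁} ⋯ Uₙ^{jₙ}`. -/
def multiPower {n : ℕ} (U : Fin n → Ω ≃ᵐ Ω) (j : Fin n → ℤ) : Equiv.Perm Ω :=
  (List.ofFn fun i => ((U i).toEquiv : Equiv.Perm Ω) ^ j i).prod

/-- The strong ergodic maximal operator associated with `U₁, …, Uₙ`. -/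
def ergodicMaximal {n : ℕ} (U : Fin n → Ω ≃ᵐ Ω) (f : Ω → ℝ) (ω : Ω) : ℝ≥0∞ :=
  ⨆ (a : Fin n → ℝ) (b : Fin n → ℝ) (_ : (0 : Fin n → ℝ) ∈ openRect a b),
    (∑ j ∈ latticePoints a b, ‖f (multiPower U j ω)‖ₑ) /
      ((latticePoints a b).card : ℝ≥0∞)

/-- The Tauberian constant of the strong ergodic maximal operator, a supremum over the
measurable sets `E` of positive measure. -/
def ergodicTauberian {n : ℕ} (μ : Measure Ω) (U : Fin n → Ω ≃ᵐ Ω) (α : ℝ) : ℝ≥0∞ :=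
  ⨆ (E : Set Ω) (_ : MeasurableSet E) (_ : 0 < μ E),
    μ {ω | ENNReal.ofReal α < ergodicMaximal U (E.indicator 1) ω} / μ E

/-- The collection `U₁, …, Uₙ` is non-periodic: for every `l ∈ ℤⁿ \ {0}` the set of fixed
points of `U₁^{l₁} ⋯ Uₙ^{lₙ}` is a null set. -/
def NonPeriodic {n : ℕ} (μ : Measure Ω) (U : Fin n → Ω ≃ᵐ Ω) : Prop :=
  ∀ l : Fin n → ℤ, l ≠ 0 → μ {x | multiPower U l x = x} = 0

/-- Some sequence of measurable sets separates the points of `Ω` outside a null set. All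
standard Borel and all Lebesgue probability spaces have this property. -/
def CountablySeparatedModNull (μ : Measure Ω) : Prop :=
  ∃ (N : Set Ω) (S : ℕ → Set Ω), μ N = 0 ∧ (∀ k, MeasurableSet (S k)) ∧
    ∀ x ∉ N, ∀ y ∉ N, (∀ k, x ∈ S k ↔ y ∈ S k) → x = y

end StrongMaximal

end

open MeasureTheory Filter Topology
open scoped ENNReal

namespace StrongMaximal

/-! The two inequalities are independent. Upper bound for `ergodicTauberian`: Calderón transference
(`measure_lt_ergodicMaximal_le`). Along each orbit the discrete inequality bounds the visits to the
maximal set during a large cube of times by the visits to `E` during a slightly larger cube.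
Integrate in `ω`, then let the cube grow. Lower bound: a finite configuration in `ℤⁿ` is copied into
`Ω` (`card_le_ergodicTauberian_mul`). Non-periodicity and separation give a set `B` of positive
measure with as many disjoint translates as required. Since `μ B` cancels, `B` may be tiny, and no
Rokhlin tower filling most of `Ω` is needed. -/

/-- The finite sets `R ∩ ℤⁿ`, where `R` is an open rectangle containing the origin. -/
def latticeRects (n : ℕ) : Set (Finset (Fin n → ℤ)) :=
  {s | ∃ a b : Fin n → ℝ, (0 : Fin n → ℝ) ∈ openRect a b ∧ latticePoints a b = s}

/-- The average of `|g|` over a finite set. -/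
noncomputable def absAverage {ι : Type*} (s : Finset ι) (g : ι → ℝ) : ℝ≥0∞ :=
  (∑ j ∈ s, ‖g j‖ₑ) / (s.card : ℝ≥0∞)

theorem absAverage_mono {ι : Type*} {s : Finset ι} {g h : ι → ℝ}
    (H : ∀ j ∈ s, ‖g j‖ₑ ≤ ‖h j‖ₑ) : absAverage s g ≤ absAverage s h :=
  ENNReal.div_le_div_right (Finset.sum_le_sum H) _

theorem lt_discreteMaximal_iff {n : ℕ} {f : (Fin n → ℤ) → ℝ} {m : Fin n → ℤ} {c : ℝ≥0∞} :
    c < discreteMaximal f m ↔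
      ∃ s ∈ latticeRects n, c < absAverage s fun j => f (m + j) := by
  simp only [discreteMaximal, lt_iSup_iff, latticeRects, absAverage]
  constructor
  · rintro ⟨a, b, h, hc⟩
    exact ⟨_, ⟨a, b, h, rfl⟩, hc⟩
  · rintro ⟨_, ⟨a, b, h, rfl⟩, hc⟩
    exact ⟨a, b, h, hc⟩

theorem lt_ergodicMaximal_iff {Ω : Type*} [MeasurableSpace Ω] {n : ℕ} {U : Fin n → Ω ≃ᵐ Ω}
    {f : Ω → ℝ} {ω : Ω} {c : ℝ≥0∞} :
    c < ergodicMaximal U f ω ↔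
      ∃ s ∈ latticeRects n, c < absAverage s fun j => f (multiPower U j ω) := by
  simp only [ergodicMaximal, lt_iSup_iff, latticeRects, absAverage]
  constructor
  · rintro ⟨a, b, h, hc⟩
    exact ⟨_, ⟨a, b, h, rfl⟩, hc⟩
  · rintro ⟨_, ⟨a, b, h, rfl⟩, hc⟩
    exact ⟨a, b, h, hc⟩

/-! ### The measure-preserving action of `ℤⁿ`. -/

section Action

variable {Ω : Type*} [MeasurableSpace Ω] {n : ℕ}

theorem multiPower_add {U : Fin n → Ω ≃ᵐ Ω} (hcomm : ∀ i j ω, U i (U j ω) = U j (U i ω))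
    (j k : Fin n → ℤ) : multiPower U (j + k) = multiPower U j * multiPower U k := by
  have hC : ∀ i i', Commute ((U i).toEquiv : Equiv.Perm Ω) ((U i').toEquiv : Equiv.Perm Ω) :=
    fun i i' => Equiv.ext fun ω => hcomm i i' ω
  unfold multiPower
  clear hcomm
  induction n with
  | zero => simp
  | succ n ih =>
    have h := ih (U := fun i => U i.succ) (fun i => j i.succ) (fun i => k i.succ)
      fun i i' => hC _ _
    simp only [Pi.add_apply] at h
    simp only [List.ofFn_succ, List.prod_cons, Pi.add_apply]
    rw [h, zpow_add]
    have hc : Commute (((U 0).toEquiv : Equiv.Perm Ω) ^ k 0)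
        (List.ofFn fun i : Fin n => ((U i.succ).toEquiv : Equiv.Perm Ω) ^ j i.succ).prod := by
      apply Commute.list_prod_right
      intro x hx
      obtain ⟨i, rfl⟩ := (List.mem_ofFn' _ _).1 hx
      exact (hC _ _).zpow_zpow _ _
    simp only [mul_assoc]
    rw [← mul_assoc (((U 0).toEquiv : Equiv.Perm Ω) ^ k 0), hc.eq]
    simp only [mul_assoc]

theorem multiPower_add_apply {U : Fin n → Ω ≃ᵐ Ω}
    (hcomm : ∀ i j ω, U i (U j ω) = U j (U i ω)) (j k : Fin n → ℤ) (ω : Ω) :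
    multiPower U (j + k) ω = multiPower U k (multiPower U j ω) := by
  rw [add_comm, multiPower_add hcomm]
  rfl

/-- The group of permutations that preserve `μ` in both directions. -/
def measurePreservingPerms (μ : Measure Ω) : Subgroup (Equiv.Perm Ω) where
  carrier := {e | MeasurePreserving e μ μ ∧ MeasurePreserving e.symm μ μ}
  one_mem' := ⟨MeasurePreserving.id μ, MeasurePreserving.id μ⟩
  mul_mem' {e e'} h h' := by
    obtain ⟨⟨h₁, h₂⟩, ⟨h₁', h₂'⟩⟩ := And.intro h h'
    exact ⟨h₁.comp h₁', h₂'.comp h₂⟩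
  inv_mem' {_} h := And.symm h

theorem measurePreserving_multiPower {μ : Measure Ω} {U : Fin n → Ω ≃ᵐ Ω}
    (hU : ∀ i, MeasurePreserving (U i) μ μ) (j : Fin n → ℤ) :
    MeasurePreserving (multiPower U j) μ μ := by
  have h : multiPower U j ∈ measurePreservingPerms μ := by
    apply Subgroup.list_prod_mem
    intro x hx
    obtain ⟨i, rfl⟩ := (List.mem_ofFn' _ _).1 hx
    have hi : ((U i).toEquiv : Equiv.Perm Ω) ∈ measurePreservingPerms μ :=
      And.intro (hU i) (hU i).symm
    exact Subgroup.zpow_mem _ hi _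
  exact And.left h

theorem measurableSet_lt_absAverage {μ : Measure Ω} {U : Fin n → Ω ≃ᵐ Ω}
    (hU : ∀ i, MeasurePreserving (U i) μ μ) {E : Set Ω} (hE : MeasurableSet E) (c : ℝ≥0∞)
    (s : Finset (Fin n → ℤ)) :
    MeasurableSet {ω | c < absAverage s fun j => E.indicator (1 : Ω → ℝ) (multiPower U j ω)} := by
  apply measurableSet_lt measurable_const
  unfold absAverage
  refine Measurable.div_const (Finset.measurable_sum _ fun j _ => ?_) _
  exact ((measurable_one.indicator hE).comp (measurePreserving_multiPower hU j).measurable).enorm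

end Action

/-! ### Transference from `ℤⁿ` to `Ω`. -/

section Transference

variable {Ω : Type*} [MeasurableSpace Ω] {n : ℕ}

/-- The cube `[-L, L]ⁿ ∩ ℤⁿ`. -/
noncomputable def latticeCube (n L : ℕ) : Finset (Fin n → ℤ) :=
  Finset.Icc (fun _ => -(L : ℤ)) (fun _ => (L : ℤ))

theorem card_latticeCube (n L : ℕ) : (latticeCube n L).card = (2 * L + 1) ^ n := by
  have : ((L : ℤ) + 1 + L).toNat = 2 * L + 1 := by omega
  simp [latticeCube, Pi.card_Icc, this]

theorem mem_latticeCube {L : ℕ} {j : Fin n → ℤ} :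
    j ∈ latticeCube n L ↔ ∀ i, |j i| ≤ L := by
  simp [latticeCube, Pi.le_def, abs_le, forall_and]

theorem add_mem_latticeCube {L K : ℕ} {j k : Fin n → ℤ} (hj : j ∈ latticeCube n L)
    (hk : k ∈ latticeCube n K) : j + k ∈ latticeCube n (L + K) := by
  rw [mem_latticeCube] at *
  intro i
  push_cast
  exact (abs_add_le _ _).trans (add_le_add (hj i) (hk i))

theorem exists_subset_latticeCube (s : Finset (Fin n → ℤ)) : ∃ K, s ⊆ latticeCube n K := by
  refine ⟨∑ j ∈ s, ∑ i, (j i).natAbs, fun j hj => mem_latticeCube.2 fun i => ?_⟩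
  rw [Int.abs_eq_natAbs]
  have h₁ : (j i).natAbs ≤ ∑ i, (j i).natAbs :=
    Finset.single_le_sum (f := fun i => (j i).natAbs) (fun _ _ => Nat.zero_le _)
      (Finset.mem_univ i)
  have h₂ : ∑ i, (j i).natAbs ≤ ∑ j ∈ s, ∑ i, (j i).natAbs :=
    Finset.single_le_sum (f := fun j : Fin n → ℤ => ∑ i, (j i).natAbs)
      (fun _ _ => Nat.zero_le _) hj
  exact_mod_cast h₁.trans h₂

/-- The Følner property of cubes: enlarging the cube of times by a fixed `K` costs nothing in the
limit. -/
theorem tendsto_card_latticeCube_ratio (n K : ℕ) :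
    Tendsto (fun L : ℕ => ((latticeCube n (L + K)).card : ℝ≥0∞) / (latticeCube n L).card)
      atTop (𝓝 1) := by
  have h₁ : Tendsto (fun L : ℕ => (1 + (2 * K : ℝ) / (2 * L + 1)) ^ n) atTop (𝓝 1) := by
    have h₂ : Tendsto (fun L : ℕ => (2 * L + 1 : ℝ)) atTop atTop :=
      tendsto_atTop_add_const_right _ _
        (tendsto_natCast_atTop_atTop.const_mul_atTop (by norm_num))
    simpa using ((tendsto_const_nhds.div_atTop h₂).const_add (1 : ℝ)).pow n
  have h₃ := ENNReal.tendsto_ofReal h₁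
  rw [ENNReal.ofReal_one] at h₃
  refine h₃.congr fun L => ?_
  have hL : (0 : ℝ) < 2 * L + 1 := by positivity
  rw [card_latticeCube, card_latticeCube, ← ENNReal.ofReal_natCast, ← ENNReal.ofReal_natCast,
    ← ENNReal.ofReal_div_of_pos (by positivity)]
  congr 1
  push_cast
  rw [← div_pow]
  congr 1
  field_simp
  ring

theorem encard_lt_discreteMaximal_le (E : Finset (Fin n → ℤ)) (α : ℝ) :
    ({m : Fin n → ℤ | ENNReal.ofReal α <
        discreteMaximal ((E : Set (Fin n → ℤ)).indicator 1) m}.encard : ℝ≥0∞) ≤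
      discreteTauberian n α * E.card := by
  -- The empty set is excluded from the supremum, but an orbit may miss `E` throughout a cube.
  rcases E.eq_empty_or_nonempty with rfl | hE
  · have : {m : Fin n → ℤ | ENNReal.ofReal α <
        discreteMaximal (((∅ : Finset (Fin n → ℤ)) : Set (Fin n → ℤ)).indicator 1) m} = ∅ := by
      ext m
      simp [lt_discreteMaximal_iff, absAverage]
    rw [this]
    simp
  · have h := le_iSup₂_of_le (f := fun (E : Finset (Fin n → ℤ)) (_ : E.Nonempty) =>
      ({m : Fin n → ℤ | ENNReal.ofReal α <
        discreteMaximal ((E : Set (Fin n → ℤ)).indicator 1) m}.encard : ℝ≥0∞) /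
      (E.card : ℝ≥0∞)) E hE le_rfl
    exact (ENNReal.div_le_iff (by simpa using hE.ne_empty) (by simp)).1 h

/-- Both sums count visits of one orbit. The discrete bound is applied to the set of times in the
larger cube at which the orbit lies in `E`; rectangles based in the smaller cube see no other times.
-/
theorem sum_indicator_orbit_le {U : Fin n → Ω ≃ᵐ Ω}
    (hcomm : ∀ i j ω, U i (U j ω) = U j (U i ω)) (E : Set Ω) (α : ℝ)
    {t : Finset (Finset (Fin n → ℤ))} {K : ℕ} (hK : ∀ s ∈ t, s ⊆ latticeCube n K) (L : ℕ)
    (ω : Ω) :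
    ∑ m ∈ latticeCube n L, {ω | ∃ s ∈ t, s ∈ latticeRects n ∧ ENNReal.ofReal α <
        absAverage s fun j => E.indicator (1 : Ω → ℝ) (multiPower U j ω)}.indicator
          (1 : Ω → ℝ≥0∞) (multiPower U m ω) ≤
      discreteTauberian n α *
        ∑ m ∈ latticeCube n (L + K), E.indicator (1 : Ω → ℝ≥0∞) (multiPower U m ω) := by
  classical
  set A := {ω | ∃ s ∈ t, s ∈ latticeRects n ∧ ENNReal.ofReal α <
        absAverage s fun j => E.indicator (1 : Ω → ℝ) (multiPower U j ω)} with hA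
  have hsum : ∀ (B : Set Ω) (Q : Finset (Fin n → ℤ)),
      ∑ m ∈ Q, B.indicator (1 : Ω → ℝ≥0∞) (multiPower U m ω) =
        ((Q.filter fun m => multiPower U m ω ∈ B).card : ℝ≥0∞) := by
    intro B Q
    simp [Set.indicator_apply]
  rw [hsum, hsum]
  refine le_trans ?_ (encard_lt_discreteMaximal_le _ α)
  rw [← ENat.toENNReal_coe, ← Set.encard_coe_eq_coe_finsetCard, ENat.toENNReal_le]
  refine Set.encard_le_encard fun m hm => ?_
  obtain ⟨hmL, s, hst, hs, hlt⟩ := by simpa [hA] using hm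
  refine lt_discreteMaximal_iff.2 ⟨s, hs, hlt.trans_le (absAverage_mono fun j hj => ?_)⟩
  have hmem := add_mem_latticeCube hmL (hK s hst hj)
  simp [Set.indicator_apply, hmem, multiPower_add_apply hcomm]

theorem measurable_indicator_orbit {μ : Measure Ω} {U : Fin n → Ω ≃ᵐ Ω}
    (hU : ∀ i, MeasurePreserving (U i) μ μ) {B : Set Ω} (hB : MeasurableSet B)
    (m : Fin n → ℤ) : Measurable fun ω => B.indicator (1 : Ω → ℝ≥0∞) (multiPower U m ω) :=
  (measurable_one.indicator hB).comp (measurePreserving_multiPower hU m).measurable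

theorem lintegral_sum_indicator_orbit {μ : Measure Ω} {U : Fin n → Ω ≃ᵐ Ω}
    (hU : ∀ i, MeasurePreserving (U i) μ μ) {B : Set Ω} (hB : MeasurableSet B)
    (Q : Finset (Fin n → ℤ)) :
    ∫⁻ ω, ∑ m ∈ Q, B.indicator (1 : Ω → ℝ≥0∞) (multiPower U m ω) ∂μ = Q.card * μ B := by
  have hm : Measurable (B.indicator (1 : Ω → ℝ≥0∞)) := measurable_one.indicator hB
  rw [lintegral_finsetSum _ fun m _ => measurable_indicator_orbit hU hB m]
  simp [(measurePreserving_multiPower hU _).lintegral_comp hm, lintegral_indicator_one hB]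

theorem measure_lt_ergodicMaximal_le {μ : Measure Ω} {U : Fin n → Ω ≃ᵐ Ω}
    (hU : ∀ i, MeasurePreserving (U i) μ μ)
    (hcomm : ∀ i j ω, U i (U j ω) = U j (U i ω)) {E : Set Ω} (hE : MeasurableSet E) (α : ℝ) :
    μ {ω | ENNReal.ofReal α < ergodicMaximal U (E.indicator 1) ω} ≤
      discreteTauberian n α * μ E := by
  -- Restricting to finitely many rectangles puts them all in one cube of radius `K`; continuity
  -- from below recovers the full maximal set.
  let A : Finset (Finset (Fin n → ℤ)) → Set Ω := fun t =>
    {ω | ∃ s ∈ t, s ∈ latticeRects n ∧ ENNReal.ofReal α <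
        absAverage s fun j => E.indicator (1 : Ω → ℝ) (multiPower U j ω)}
  have hAmeas : ∀ t, MeasurableSet (A t) := by
    intro t
    have : A t = ⋃ s ∈ t, ⋃ (_ : s ∈ latticeRects n), {ω | ENNReal.ofReal α <
        absAverage s fun j => E.indicator (1 : Ω → ℝ) (multiPower U j ω)} := by
      ext ω
      simp only [A, Set.mem_ofPred_eq, Set.mem_iUnion, exists_prop]
    rw [this]
    exact t.measurableSet_biUnion fun s _ =>
      MeasurableSet.iUnion fun _ => measurableSet_lt_absAverage hU hE _ s
  have hmono : Monotone A := fun t t' h ω ⟨s, hs, hω⟩ => ⟨s, h hs, hω⟩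
  have hunion : {ω | ENNReal.ofReal α < ergodicMaximal U (E.indicator 1) ω} = ⋃ t, A t := by
    ext ω
    simp only [Set.mem_ofPred_eq, lt_ergodicMaximal_iff, Set.mem_iUnion, A]
    constructor
    · rintro ⟨s, hs, h⟩
      exact ⟨{s}, s, Finset.mem_singleton_self s, hs, h⟩
    · rintro ⟨_, s, _, hs, h⟩
      exact ⟨s, hs, h⟩
  rw [hunion, hmono.directed_le.measure_iUnion]
  refine iSup_le fun t => ?_
  obtain ⟨K, hK⟩ := exists_subset_latticeCube (t.biUnion id)
  have hK' : ∀ s ∈ t, s ⊆ latticeCube n K := fun s hs =>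
    (Finset.subset_biUnion_of_mem id hs).trans hK
  have key : ∀ L : ℕ, μ (A t) ≤ ((latticeCube n (L + K)).card : ℝ≥0∞) / (latticeCube n L).card *
      (discreteTauberian n α * μ E) := by
    intro L
    have h := lintegral_mono (μ := μ) (sum_indicator_orbit_le hcomm E α hK' L)
    rw [lintegral_sum_indicator_orbit hU (hAmeas t), lintegral_const_mul _
      (Finset.measurable_sum _ fun m _ => measurable_indicator_orbit hU hE m),
      lintegral_sum_indicator_orbit hU hE] at h
    have h₀ : ((latticeCube n L).card : ℝ≥0∞) ≠ 0 := by
      rw [card_latticeCube]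
      positivity
    rw [← ENNReal.mul_le_mul_iff_right h₀ (ENNReal.natCast_ne_top _), ← mul_assoc,
      ENNReal.mul_div_cancel h₀ (ENNReal.natCast_ne_top _)]
    exact h.trans_eq (by ring)
  -- The Tauberian constant may be `∞`; the limit survives because the ratio tends to `1 ≠ 0`.
  have hlim := ENNReal.Tendsto.mul_const (b := discreteTauberian n α * μ E)
    (tendsto_card_latticeCube_ratio n K) (Or.inl one_ne_zero)
  rw [one_mul] at hlim
  exact ge_of_tendsto' hlim key

end Transference

/-! ### Disjoint translates and the lower bound. -/

section Towers

variable {Ω : Type*} [MeasurableSpace Ω] {n : ℕ}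

/-- The part of `B` that `T` moves across the boundary of some `S k`, in a given direction, is
disjoint from its image. If all these parts were null, almost no `x ∈ B` would be separated from `T
x`, making `T x = x` almost everywhere on `B`. -/
theorem exists_subset_forall_notMem {μ : Measure Ω} (hsep : CountablySeparatedModNull μ)
    {T : Ω → Ω} (hT : MeasurePreserving T μ μ) (hfix : μ {x | T x = x} = 0) {B : Set Ω}
    (hB : MeasurableSet B) (hμB : 0 < μ B) :
    ∃ B' ⊆ B, MeasurableSet B' ∧ 0 < μ B' ∧ ∀ x ∈ B', T x ∉ B' := by
  obtain ⟨N, S, hN, hS, hNS⟩ := hsep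
  by_contra! H
  have h₁ : ∀ k, μ (B ∩ (S k ∩ T ⁻¹' (S k)ᶜ)) = 0 := by
    intro k
    by_contra h
    obtain ⟨x, hx, hx'⟩ := H _ Set.inter_subset_left
      (hB.inter ((hS k).inter (hT.measurable (hS k).compl))) (pos_iff_ne_zero.2 h)
    exact hx.2.2 hx'.2.1
  have h₂ : ∀ k, μ (B ∩ ((S k)ᶜ ∩ T ⁻¹' S k)) = 0 := by
    intro k
    by_contra h
    obtain ⟨x, hx, hx'⟩ := H _ Set.inter_subset_left
      (hB.inter ((hS k).compl.inter (hT.measurable (hS k)))) (pos_iff_ne_zero.2 h)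
    exact hx'.2.1 hx.2.2
  have hsub : B ⊆ ((⋃ k, B ∩ (S k ∩ T ⁻¹' (S k)ᶜ)) ∪ ⋃ k, B ∩ ((S k)ᶜ ∩ T ⁻¹' S k)) ∪
      ((N ∪ T ⁻¹' N) ∪ {x | T x = x}) := by
    intro x hx
    by_contra hx'
    simp only [Set.mem_union, Set.mem_iUnion, not_or, not_exists] at hx'
    obtain ⟨⟨ha, hb⟩, ⟨hc, hd⟩, he⟩ := hx'
    refine he (hNS (T x) hd x hc fun k => ⟨fun h => ?_, fun h => ?_⟩)
    · by_contra h'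
      exact hb k ⟨hx, h', h⟩
    · by_contra h'
      exact ha k ⟨hx, h, h'⟩
  refine hμB.ne' (measure_mono_null hsub ?_)
  simp only [measure_union_null_iff, measure_iUnion_null_iff]
  exact ⟨⟨h₁, h₂⟩, ⟨hN, hT.quasiMeasurePreserving.preimage_null hN⟩, hfix⟩

theorem exists_measurableSet_forall_notMem {μ : Measure Ω} [NeZero μ]
    (hsep : CountablySeparatedModNull μ) {U : Fin n → Ω ≃ᵐ Ω}
    (hU : ∀ i, MeasurePreserving (U i) μ μ) (hnp : NonPeriodic μ U)
    (D : Finset (Fin n → ℤ)) (hD : 0 ∉ D) :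
    ∃ B, MeasurableSet B ∧ 0 < μ B ∧ ∀ l ∈ D, ∀ x ∈ B, multiPower U l x ∉ B := by
  classical
  -- Subsets inherit the property, so `B` can be shrunk for one `l` at a time.
  induction D using Finset.induction_on with
  | empty => exact ⟨Set.univ, MeasurableSet.univ, NeZero.pos _, by simp⟩
  | insert l D _ ih =>
    rw [Finset.mem_insert, not_or] at hD
    obtain ⟨B, hB, hμB, h⟩ := ih hD.2
    obtain ⟨B', hsub, hB', hμB', h'⟩ := exists_subset_forall_notMem hsep
      (measurePreserving_multiPower hU l) (hnp l (Ne.symm hD.1)) hB hμB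
    refine ⟨B', hB', hμB', fun k hk x hx => ?_⟩
    rcases Finset.mem_insert.1 hk with rfl | hk
    · exact h' x hx
    · exact fun hx' => h k hk x (hsub hx) (hsub hx')

theorem card_le_ergodicTauberian_mul {μ : Measure Ω} [IsProbabilityMeasure μ]
    (hsep : CountablySeparatedModNull μ) {U : Fin n → Ω ≃ᵐ Ω}
    (hU : ∀ i, MeasurePreserving (U i) μ μ)
    (hcomm : ∀ i j ω, U i (U j ω) = U j (U i ω)) (hnp : NonPeriodic μ U) (α : ℝ)
    {E F : Finset (Fin n → ℤ)} (hE : E.Nonempty)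
    (hF : (F : Set (Fin n → ℤ)) ⊆ {m | ENNReal.ofReal α <
        discreteMaximal ((E : Set (Fin n → ℤ)).indicator 1) m}) :
    (F.card : ℝ≥0∞) ≤ ergodicTauberian μ U α * E.card := by
  classical
  -- Avoiding the nonzero differences of `F` makes the translates over `F` disjoint. Those over `E`
  -- may overlap: only the upper bound `hμX` is used.
  obtain ⟨B, hB, hμB, hdisj⟩ := exists_measurableSet_forall_notMem hsep hU hnp
    ((Finset.image₂ (fun k m => m - k) F F).erase 0) (Finset.notMem_erase _ _)
  -- The translate of `B` by `U^m`, written as a preimage.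
  let T : (Fin n → ℤ) → Set Ω := fun m => multiPower U (-m) ⁻¹' B
  have hT : ∀ m, MeasurableSet (T m) := fun m =>
    (measurePreserving_multiPower hU _).measurable hB
  have hμT : ∀ m, μ (T m) = μ B := fun m =>
    (measurePreserving_multiPower hU _).measure_preimage hB.nullMeasurableSet
  let X : Set Ω := ⋃ m ∈ E, T m
  have hX : MeasurableSet X := E.measurableSet_biUnion fun m _ => hT m
  have hμX : μ X ≤ E.card * μ B := by
    refine (measure_biUnion_finset_le E T).trans_eq ?_
    simp [hμT]
  have hμX₀ : 0 < μ X := by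
    obtain ⟨m, hm⟩ := hE
    exact hμB.trans_le ((hμT m).symm.le.trans
      (measure_mono (Set.subset_biUnion_of_mem (u := T) hm)))
  have hpair : (F : Set (Fin n → ℤ)).PairwiseDisjoint T := by
    intro m hm k hk hmk
    refine Set.disjoint_left.2 fun x hx hx' => ?_
    refine hdisj (m - k) (Finset.mem_erase.2 ⟨sub_ne_zero.2 hmk,
      Finset.mem_image₂_of_mem hk hm⟩) _ hx ?_
    rw [← multiPower_add_apply hcomm, neg_add_eq_sub, sub_sub_cancel_left]
    exact hx'
  have hsub : ⋃ m ∈ F, T m ⊆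
      {ω | ENNReal.ofReal α < ergodicMaximal U (X.indicator 1) ω} := by
    refine Set.iUnion₂_subset fun m hm ω hω => ?_
    obtain ⟨s, hs, hlt⟩ := lt_discreteMaximal_iff.1 (hF hm)
    refine lt_ergodicMaximal_iff.2 ⟨s, hs, hlt.trans_le (absAverage_mono fun j _ => ?_)⟩
    by_cases hj : m + j ∈ E
    · have : multiPower U j ω ∈ X := by
        refine Set.mem_biUnion hj ?_
        change multiPower U _ (multiPower U j ω) ∈ B
        rw [← multiPower_add_apply hcomm]
        simpa [T] using hω
      simp [hj, this]
    · simp [Set.indicator_apply, hj]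
  have h₁ : (F.card : ℝ≥0∞) * μ B ≤ ergodicTauberian μ U α * (E.card * μ B) := by
    calc (F.card : ℝ≥0∞) * μ B = μ (⋃ m ∈ F, T m) := by
          rw [measure_biUnion_finset hpair fun m _ => hT m]
          simp [hμT]
      _ ≤ μ {ω | ENNReal.ofReal α < ergodicMaximal U (X.indicator 1) ω} := measure_mono hsub
      _ ≤ ergodicTauberian μ U α * μ X := by
          refine (ENNReal.div_le_iff hμX₀.ne' (measure_ne_top _ _)).1 ?_
          exact le_iSup_of_le X (le_iSup₂_of_le hX hμX₀ le_rfl)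
      _ ≤ _ := by gcongr
  rw [← mul_assoc] at h₁
  exact (ENNReal.mul_le_mul_iff_left hμB.ne' (measure_ne_top _ _)).1 h₁

end Towers

/-- Lets the lower bound treat finite parts of the discrete maximal set, without knowing that the
whole set is finite. -/
theorem toENNReal_encard_le {ι : Type*} {X : Set ι} {c : ℝ≥0∞}
    (h : ∀ F : Finset ι, (F : Set ι) ⊆ X → (F.card : ℝ≥0∞) ≤ c) :
    (X.encard : ℝ≥0∞) ≤ c := by
  by_cases hX : X.Finite
  · have := h hX.toFinset (by simp)
    rwa [hX.encard_eq_coe_toFinset_card, ENat.toENNReal_coe]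
  · have : c = ∞ := by
      refine ENNReal.eq_top_of_forall_nnreal_le fun r => ?_
      obtain ⟨k, hk⟩ := exists_nat_ge r
      obtain ⟨F, hF, hFk⟩ := Set.Infinite.exists_subset_card_eq hX k
      refine le_trans ?_ (h F hF)
      rw [hFk]
      exact_mod_cast hk
    simp [this]

end StrongMaximal

theorem lemmal {Ω : Type*} [MeasurableSpace Ω] (μ : MeasureTheory.Measure Ω)
    [MeasureTheory.IsProbabilityMeasure μ]
    (hsep : StrongMaximal.CountablySeparatedModNull μ)
    (n : ℕ) (U : Fin n → Ω ≃ᵐ Ω)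
    (hU : ∀ i, MeasureTheory.MeasurePreserving (U i) μ μ)
    (hcomm : ∀ i j ω, U i (U j ω) = U j (U i ω))
    (hnp : StrongMaximal.NonPeriodic μ U)
    (α : ℝ) (hα₀ : 0 < α) (hα₁ : α < 1) :
    StrongMaximal.ergodicTauberian μ U α = StrongMaximal.discreteTauberian n α := by
  apply le_antisymm
  · refine iSup_le fun E => iSup₂_le fun hE hμE => ?_
    exact (ENNReal.div_le_iff hμE.ne' (measure_ne_top _ _)).2
      (StrongMaximal.measure_lt_ergodicMaximal_le hU hcomm hE α)
  · refine iSup₂_le fun E hE => ?_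
    refine (ENNReal.div_le_iff (by simpa using hE.ne_empty) (ENNReal.natCast_ne_top _)).2 ?_
    exact StrongMaximal.toENNReal_encard_le fun F hF =>
      StrongMaximal.card_le_ergodicTauberian_mul hsep hU hcomm hnp α hE hF
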